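/- **Setting.** A probabilistic social graph $G=(V,E)$ has $n$ nodes, $m$ directed edges and a probability $p(e)\in(0,1]$ for every edge $e$. A random realization $\Phi$ keeps every edge $e$ independently with probability $p(e)$. $\mathbb E[I_G(S)]$ is the expected number of nodes reachable from $S$ in a random realization of $G$, and $v^\circ$ is a node that maximizes $\mathbb E[I_G(\{v\})]$. A random RR set on a graph is generated by choosing a uniformly random root and running a breadth-first search from it along reversed edges, where each edge is examined at most once and is live, independently, with its probability. For a list $\mathcal R$ of RR sets, $\mathrm{Cov}_{\mathcal R}(S)$ is the number of sets in $\mathcal R$ that meet $S$, and $\mathrm{Cov}_{\mathcal R}(u\mid S)=\mathrm{Cov}_{\mathcal R}(S\cup\{u\})-\mathrm{Cov}_{\mathcal R}(S)$. **AddATP.** The input is $G$, target nodes $u_1,\dots,u_k$ (distinct nodes of $G$), real costs $c(u)$ and an initial error $\zeta_0$, which may depend on the number $n_i$ of nodes of the current residual graph. Start with $S_0=\emptyset$, $T_0=\{u_1,\dots,u_k\}$, $G_1=G$. In iteration $i=1,\dots,k$: if $u_i$ is not in $G_i$ (it is already activated), set $S_i=S_{i-1}$, $T_i=T_{i-1}\setminus\{u_i\}$,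 $G_{i+1}=G_i$. Otherwise set $\zeta=\zeta_0(n_i)$, $\delta=1/(kn)$ and repeat the following: generate two independent collections $\mathcal R_1,\mathcal R_2$ of $\theta=\lceil\frac{1}{2\zeta^2}\ln\frac8\delta\rceil$ independent random RR sets on $G_i$; put $\tilde\rho_f=\mathrm{Cov}_{\mathcal R_1}(u_i\mid S_{i-1})\frac{n_i}{\theta}-c(u_i)$ and $\tilde\rho_r=c(u_i)-\mathrm{Cov}_{\mathcal R_2}(u_i\mid T_{i-1}\setminus\{u_i\})\frac{n_i}{\theta}$; stop if $|\tilde\rho_f-\tilde\rho_r|\ge 2n_i\zeta$ or $\tilde\rho_f\le -n_i\zeta$ or $\tilde\rho_r\le -n_i\zeta$ or $n_i\zeta\le 1$; else replace $\zeta$ by $\zeta/\sqrt2$ and $\delta$ by $\delta/2$. After stopping, if $\tilde\rho_f\ge\tilde\rho_r$, set $S_i=S_{i-1}\cup\{u_i\}$, $T_i=T_{i-1}$, and let $G_{i+1}$ be $G_i$ without the nodes that $u_i$ activates in $G_i$ under the realization $\Phi$; otherwise set $S_i=S_{i-1}$, $T_i=T_{i-1}\setminus\{u_i\}$, $G_{i+1}=G_i$.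 **Theorem.** For every $\kappa>0$ there is a constant $C>0$, depending only on $\kappa$, such that the following holds for every $G$ with $n\ge2$, all targets, all costs, and every initial error with $\kappa/r\le\zeta_0(r)\le1$ for $1\le r\le n$ (for example a fixed number $\zeta_0=\kappa\in(0,1]$, or any $\zeta_0(n_i)\in[1/n_i,1]$ with $\kappa=1$). Expectations are over $\Phi$ and the internal randomness of the algorithm. 1. The expected number of edges that AddATP examines while generating RR sets is at most $C\,k\,m\,n\,\mathbb E[I_G(\{v^\circ\})]\ln n$. 2. If $n\le 2m$ (for example if $G$ has no isolated node), then the expected total running time of AddATP is also at most $C\,k\,m\,n\,\mathbb E[I_G(\{v^\circ\})]\ln n$. The running time charges one unit for every edge examination, every choice of a root, every insertion of a node into an RR set, every inspection of a node of an RR set when coverage is computed, every round and every iteration, and $n_i+m_i$ units (the numbers of nodes and edges of $G_i$) for the update of the residual graph after a selection. -/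

import Mathlib

open scoped ENNReal

/-! ## Probabilistic social graphs, realizations and spread -/

/-- A probabilistic social graph: a finite node set, a set of directed edges between nodes, and a
probability in `(0, 1]` for every edge. -/
structure ProbGraph (V : Type*) where
  nodes : Finset V
  edges : Finset (V × V)
  src_mem : ∀ e ∈ edges, e.1 ∈ nodes
  tgt_mem : ∀ e ∈ edges, e.2 ∈ nodes
  prob : V × V → ℝ
  prob_pos : ∀ e ∈ edges, 0 < prob e
  prob_le_one : ∀ e ∈ edges, prob e ≤ 1

namespace ProbGraph

variable {V : Type*} [DecidableEq V]

/-- `n`, the number of nodes. -/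
def n (G : ProbGraph V) : ℕ := G.nodes.card

/-- `m`, the number of edges. -/
def m (G : ProbGraph V) : ℕ := G.edges.card

/-- The residual graph that is left when the nodes of `A` (and all edges at them) are removed. -/
def remove (G : ProbGraph V) (A : Finset V) : ProbGraph V where
  nodes := G.nodes \ A
  edges := G.edges.filter fun e => e.1 ∉ A ∧ e.2 ∉ A
  src_mem e he := by
    rw [Finset.mem_filter] at he
    exact Finset.mem_sdiff.2 ⟨G.src_mem e he.1, he.2.1⟩
  tgt_mem e he := by
    rw [Finset.mem_filter] at he
    exact Finset.mem_sdiff.2 ⟨G.tgt_mem e he.1, he.2.2⟩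
  prob := G.prob
  prob_pos e he := G.prob_pos e (Finset.mem_filter.1 he).1
  prob_le_one e he := G.prob_le_one e (Finset.mem_filter.1 he).1

/-- The probability `p(φ)` of the realization whose set of live edges is `φ ⊆ E`: every edge is
kept with its probability, independently of the others. -/
noncomputable def realizationProb (G : ProbGraph V) (φ : Finset (V × V)) : ℝ :=
  (∏ e ∈ φ, G.prob e) * ∏ e ∈ G.edges \ φ, (1 - G.prob e)

theorem realizationProb_nonneg (G : ProbGraph V) {φ : Finset (V × V)} (h : φ ∈ G.edges.powerset) :
    0 ≤ G.realizationProb φ := by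
  rw [Finset.mem_powerset] at h
  refine mul_nonneg (Finset.prod_nonneg fun e he => (G.prob_pos e (h he)).le)
    (Finset.prod_nonneg fun e he => sub_nonneg.2 (G.prob_le_one e (Finset.mem_sdiff.1 he).1))

theorem sum_realizationProb (G : ProbGraph V) :
    ∑ φ ∈ G.edges.powerset, G.realizationProb φ = 1 := by
  unfold realizationProb
  rw [← Finset.prod_add]
  simp

/-- The law of a random realization `Φ ∼ Ω`, given by its set of live edges. -/
noncomputable def realizationPMF (G : ProbGraph V) : PMF (Finset (V × V)) :=
  PMF.ofFinset
    (fun φ => if φ ∈ G.edges.powerset then ENNReal.ofReal (G.realizationProb φ) else 0)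
    G.edges.powerset
    (by
      rw [Finset.sum_congr rfl fun φ hφ => if_pos hφ,
        ← ENNReal.ofReal_sum_of_nonneg fun φ hφ => G.realizationProb_nonneg hφ,
        G.sum_realizationProb, ENNReal.ofReal_one])
    (fun _ hφ => if_neg hφ)

open scoped Classical in
/-- The nodes of `G` that can be reached from `S` along the live edges `φ`. -/
noncomputable def activated (G : ProbGraph V) (φ : Finset (V × V)) (S : Finset V) : Finset V :=
  G.nodes.filter fun v => ∃ s ∈ S, Relation.ReflTransGen (fun a b => (a, b) ∈ φ) s v

/-- The expected spread `𝔼[I_G(S)] = ∑_φ I_φ(S) p(φ)`. -/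
noncomputable def expectedSpread (G : ProbGraph V) (S : Finset V) : ℝ :=
  ∑ φ ∈ G.edges.powerset, ((G.activated φ S).card : ℝ) * G.realizationProb φ

/-! ## Generation of random reverse reachable (RR) sets -/

/-- The state of the reverse breadth-first search that generates one RR set: the nodes found so
far, those found in the last level, and the number of edges examined so far. -/
structure RRSearch (V : Type*) where
  visited : Finset V
  frontier : Finset V
  examined : ℕ

/-- One level of the reverse search on `G`: all incoming edges of the frontier nodes are examined,
and the tails of the live ones that have not been visited yet form the next frontier. -/
def rrStep (G : ProbGraph V) (φ : Finset (V × V)) (s : RRSearch V) : RRSearch V where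
  visited := s.visited ∪ (φ.filter fun e => e.2 ∈ s.frontier).image Prod.fst
  frontier := (φ.filter fun e => e.2 ∈ s.frontier).image Prod.fst \ s.visited
  examined := s.examined + (G.edges.filter fun e => e.2 ∈ s.frontier).card

/-- The reverse search from the root `v`. It has at most `n` levels (once the frontier is empty
nothing changes any more). Every edge is examined at most once, so the coin of an edge may be
tossed when the edge is examined, or be read off a realization `φ` drawn beforehand. -/
def rrSearch (G : ProbGraph V) (φ : Finset (V × V)) (v : V) : RRSearch V :=
  (G.rrStep φ)^[G.n] ⟨{v}, {v}, 0⟩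

/-- A random RR set on `G`, with the record of its generation: the root is uniform over the nodes,
and the coins of the edges are independent. -/
noncomputable def rrPMF (G : ProbGraph V) (hG : G.nodes.Nonempty) : PMF (RRSearch V) :=
  (PMF.uniformOfFinset G.nodes hG).bind fun v => G.realizationPMF.map fun φ => G.rrSearch φ v

end ProbGraph

/-! ## The algorithm AddATP -/

namespace AddATP

open ProbGraph

variable {V : Type*} [DecidableEq V]

/-- `θ` independent samples from `p`. -/
noncomputable def iid {α : Type*} (p : PMF α) : ℕ → PMF (List α)
  | 0 => PMF.pure []
  | θ + 1 => p.bind fun a => (iid p θ).map fun l => a :: l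

/-- `Cov_R(S)`: the number of RR sets in `R` that overlap `S`. -/
def cov (R : List (RRSearch V)) (S : Finset V) : ℕ :=
  R.countP fun r => decide (r.visited ∩ S).Nonempty

/-- `Cov_R(u ∣ S) = Cov_R(S ∪ {u}) - Cov_R(S)`. -/
def covMarginal (R : List (RRSearch V)) (u : V) (S : Finset V) : ℝ :=
  (cov R (insert u S) : ℝ) - cov R S

/-- The time spent on a list of RR sets. An examined edge costs one unit and any other elementary
operation costs `w`: the choice of the root, the insertion of each node into the RR set, and the
inspection of each node of the RR set when the coverage is computed. -/
def samplingTime (w : ℕ) (R : List (RRSearch V)) : ℕ :=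
  (R.map fun r => r.examined + w * (1 + 2 * r.visited.card)).sum

/-- The number of RR sets per collection, `θ = ln (8 / δ) / (2 ζ²)`, rounded up. -/
noncomputable def sampleSize (ζ δ : ℝ) : ℕ := ⌈1 / (2 * ζ ^ 2) * Real.log (8 / δ)⌉₊

/-- Stopping condition `C₁`, with `x = n_i ζ_i`. -/
def StopC1 (ρf ρr x : ℝ) : Prop := 2 * x ≤ |ρf - ρr| ∨ ρf ≤ -x ∨ ρr ≤ -x

/-- Stopping condition `C₂`, with `x = n_i ζ_i`. -/
def StopC2 (x : ℝ) : Prop := x ≤ 1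

theorem ceil_sq_lt {a ζ : ℝ} (h : 1 < a * ζ) :
    ⌈(a * (ζ / √2)) ^ 2⌉₊ < ⌈(a * ζ) ^ 2⌉₊ := by
  have h2 : (√2 : ℝ) ^ 2 = 2 := Real.sq_sqrt (by norm_num)
  have e : (a * (ζ / √2)) ^ 2 = (a * ζ) ^ 2 / 2 := by
    rw [← mul_div_assoc, div_pow, h2]
  have hx : 1 < (a * ζ) ^ 2 := by nlinarith
  rw [e]
  generalize (a * ζ) ^ 2 = x at hx
  rcases le_or_gt x 2 with h' | h'
  · have h3 : ⌈x / 2⌉₊ ≤ 1 := Nat.ceil_le.2 (by norm_num; linarith)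
    have h4 : 1 < ⌈x⌉₊ := Nat.lt_ceil.2 (by exact_mod_cast hx)
    omega
  · refine Nat.lt_ceil.2 ?_
    have := Nat.ceil_lt_add_one (a := x / 2) (by linarith)
    linarith

open scoped Classical in
/-- The `while` loop for the node `u` with cost `cu` on the residual graph `G`, where `S` is
`S_{i-1}`, `T` is `T_{i-1}`, and `ζ`, `δ` are the current parameters. It returns the decision
(`true` if `u` is selected) and the time used. -/
noncomputable def loop (w : ℕ) (G : ProbGraph V) (hG : G.nodes.Nonempty) (u : V) (cu : ℝ)
    (S T : Finset V) (ζ δ : ℝ) : PMF (Bool × ℕ) :=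
  (iid (G.rrPMF hG) (sampleSize ζ δ)).bind fun R₁ =>
    (iid (G.rrPMF hG) (sampleSize ζ δ)).bind fun R₂ =>
      let ρf : ℝ := covMarginal R₁ u S * ((G.n : ℝ) / sampleSize ζ δ) - cu
      let ρr : ℝ := -(covMarginal R₂ u (T.erase u) * ((G.n : ℝ) / sampleSize ζ δ)) + cu
      let t : ℕ := w + samplingTime w R₁ + samplingTime w R₂
      if _h : StopC1 ρf ρr (G.n * ζ) ∨ StopC2 (G.n * ζ) then
        PMF.pure (decide (ρr ≤ ρf), t)
      else
        (loop w G hG u cu S T (ζ / √2) (δ / 2)).map fun r => (r.1, t + r.2)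
termination_by ⌈((G.n : ℝ) * ζ) ^ 2⌉₊
decreasing_by
  exact ceil_sq_lt (not_le.1 fun h' => _h (Or.inr h'))

/-- The state between two iterations: `S_i`, `T_i`, the residual graph, and the time used. -/
structure State (V : Type*) where
  S : Finset V
  T : Finset V
  graph : ProbGraph V
  time : ℕ

/-- One iteration, for the node `u`, when the world is the realization `Φ` and the error
parameters start from `ζ₀ n_i` and `δ₀`. A node is activated iff it has left the residual graph.
Testing this costs `w`, and removing the activated nodes costs `w` per node and edge of the current
residual graph. -/
noncomputable def iteration (w : ℕ) (c : V → ℝ) (ζ₀ : ℕ → ℝ) (δ₀ : ℝ) (Φ : Finset (V × V))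
    (u : V) (s : State V) : PMF (State V) :=
  if h : u ∈ s.graph.nodes then
    (loop w s.graph ⟨u, h⟩ u (c u) s.S s.T (ζ₀ s.graph.n) δ₀).map fun r =>
      if r.1 then
        { S := insert u s.S
          T := s.T
          graph := s.graph.remove (s.graph.activated (Φ ∩ s.graph.edges) {u})
          time := s.time + w + r.2 + w * (s.graph.n + s.graph.m) }
      else
        { S := s.S, T := s.T.erase u, graph := s.graph, time := s.time + w + r.2 }
  else
    PMF.pure { S := s.S, T := s.T.erase u, graph := s.graph, time := s.time + w }

/-- The iterations for the nodes of a list, in the order of the list. -/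
noncomputable def iterations (w : ℕ) (c : V → ℝ) (ζ₀ : ℕ → ℝ) (δ₀ : ℝ) (Φ : Finset (V × V)) :
    List V → State V → PMF (State V)
  | [], s => PMF.pure s
  | u :: us, s => (iteration w c ζ₀ δ₀ Φ u s).bind fun s' => iterations w c ζ₀ δ₀ Φ us s'

/-- AddATP on `G` with the target nodes `us = [u₁, …, u_k]`, the costs `c` and the initial error
`ζ₀ n_i` in an iteration whose residual graph has `n_i` nodes. The result is the law of the final
state, over the random realization and the internal randomness of the algorithm. -/
noncomputable def run (w : ℕ) (G : ProbGraph V) (us : List V) (c : V → ℝ) (ζ₀ : ℕ → ℝ) :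
    PMF (State V) :=
  G.realizationPMF.bind fun Φ =>
    iterations w c ζ₀ (1 / ((us.length : ℝ) * G.n)) Φ us
      { S := ∅, T := us.toFinset, graph := G, time := 0 }

/-- The expected time of AddATP when an examined edge costs one unit and every other elementary
operation costs `w` units. -/
noncomputable def expectedTime (w : ℕ) (G : ProbGraph V) (us : List V) (c : V → ℝ)
    (ζ₀ : ℕ → ℝ) : ℝ≥0∞ :=
  ∑' s, run w G us c ζ₀ s * (s.time : ℝ≥0∞)

end AddATP

/-! Fix a residual graph `H` with `N` nodes and let `I` be the largest spread of a single node of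
`G`. The reverse search from a root `v` examines an edge only if the head of the edge reaches `v`
along live edges, and it examines each edge at most once. Summing over the roots and exchanging sums
turns `N` times the expected number of examined edges into at most the sum, over the edges of `H`,
of the spreads of their heads. Each of these is at most `I`, because deleting nodes and edges cannot
increase a spread (`IsSubgraph.expectedSpread_le`). In the same way, `N` times the expected size of
an RR set is at most `N * I` (`mul_rrCost_le`).

A round with error `ζ` draws `O(log n / ζ ^ 2)` RR sets. The quantity `1 / ζ ^ 2` doubles from round
to round, and a further round occurs only while it is below `N ^ 2`; so the geometric sum gives `O(N
^ 2 log n)` samples, with a constant depending on `κ` through the initial error (`expect_loop_le`).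
One factor `N` cancels against the average over the root and the other is at most `n`, so an
iteration examines `O(m n I log n)` edges in expectation.

The RR sets use fresh coins and the bound is uniform in the subgraph and in the sets `S` and `T`.
Hence it applies conditionally on `Φ` and on the past, and summing over the `k` iterations needs no
independence between them. The weight `w` serves both claims: 0 counts edge examinations only, 1
counts all operations. Working in `ℝ≥0∞` removes all summability questions. -/

/-! ## Expectations under probability mass functions -/

namespace PMF

variable {α β : Type*}

/-- The expectation of a nonnegative function. -/
noncomputable def expect (p : PMF α) (f : α → ℝ≥0∞) : ℝ≥0∞ := ∑' a, p a * f a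

theorem expect_bind (p : PMF α) (g : α → PMF β) (f : β → ℝ≥0∞) :
    (p.bind g).expect f = p.expect fun a => (g a).expect f := by
  simp only [expect, bind_apply, ← ENNReal.tsum_mul_right, ← ENNReal.tsum_mul_left]
  rw [ENNReal.tsum_comm]
  simp only [mul_assoc]

theorem expect_pure (a : α) (f : α → ℝ≥0∞) : (PMF.pure a).expect f = f a := by
  classical
  rw [expect, tsum_eq_single a fun b hb => by simp [pure_apply, hb]]
  simp

theorem expect_map (p : PMF α) (g : α → β) (f : β → ℝ≥0∞) :
    (p.map g).expect f = p.expect fun a => f (g a) := by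
  rw [← bind_pure_comp, expect_bind]
  simp only [Function.comp_apply, expect_pure]

theorem expect_mono (p : PMF α) {f g : α → ℝ≥0∞} (h : ∀ a, f a ≤ g a) :
    p.expect f ≤ p.expect g :=
  ENNReal.tsum_le_tsum fun a => mul_le_mul_right (h a) _

theorem expect_add (p : PMF α) (f g : α → ℝ≥0∞) :
    (p.expect fun a => f a + g a) = p.expect f + p.expect g := by
  simp only [expect, mul_add, ENNReal.tsum_add]

theorem expect_const (p : PMF α) (c : ℝ≥0∞) : (p.expect fun _ => c) = c := by
  rw [expect, ENNReal.tsum_mul_right, p.tsum_coe, one_mul]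

theorem expect_const_mul (p : PMF α) (c : ℝ≥0∞) (f : α → ℝ≥0∞) :
    (p.expect fun a => c * f a) = c * p.expect f := by
  rw [expect, expect, ← ENNReal.tsum_mul_left]
  simp only [mul_left_comm]

theorem expect_uniformOfFinset (s : Finset α) (hs : s.Nonempty) (f : α → ℝ≥0∞) :
    (s.card : ℝ≥0∞) * (uniformOfFinset s hs).expect f = ∑ a ∈ s, f a := by
  rw [expect, tsum_eq_sum (s := s) fun b hb => by simp [hb], Finset.mul_sum]
  refine Finset.sum_congr rfl fun a ha => ?_
  rw [uniformOfFinset_apply_of_mem hs ha, ← mul_assoc, ENNReal.mul_inv_cancel, one_mul]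
  · exact_mod_cast hs.card_ne_zero
  · exact ENNReal.natCast_ne_top _

end PMF

namespace AddATP

theorem expect_iid_sum {α : Type*} (p : PMF α) (f : α → ℕ) (θ : ℕ) :
    ((iid p θ).expect fun l => ((l.map f).sum : ℝ≥0∞)) =
      θ * p.expect fun a => (f a : ℝ≥0∞) := by
  induction θ with
  | zero => simp [iid, PMF.expect_pure]
  | succ θ ih =>
    rw [iid, PMF.expect_bind]
    simp only [PMF.expect_map, List.map_cons, List.sum_cons, Nat.cast_add, PMF.expect_add,
      PMF.expect_const, ih]
    push_cast
    ring

end AddATP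

/-! ## Spread in subgraphs -/

namespace ProbGraph

variable {V : Type*}

/-- `H` consists of some of the nodes and edges of `G`, with the probabilities of `G`. -/
structure IsSubgraph (H G : ProbGraph V) : Prop where
  nodes_subset : H.nodes ⊆ G.nodes
  edges_subset : H.edges ⊆ G.edges
  prob_eq : H.prob = G.prob

theorem IsSubgraph.refl (G : ProbGraph V) : G.IsSubgraph G :=
  ⟨subset_rfl, subset_rfl, rfl⟩

theorem mem_activated (G : ProbGraph V) (φ : Finset (V × V)) (S : Finset V) (v : V) :
    v ∈ G.activated φ S ↔
      v ∈ G.nodes ∧ ∃ s ∈ S, Relation.ReflTransGen (fun a b => (a, b) ∈ φ) s v := by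
  simp [activated]

theorem mem_activated_singleton (G : ProbGraph V) (φ : Finset (V × V)) (x v : V) :
    v ∈ G.activated φ {x} ↔
      v ∈ G.nodes ∧ Relation.ReflTransGen (fun a b => (a, b) ∈ φ) x v := by
  simp [activated]

theorem activated_card_mono {H G : ProbGraph V} (h : H.IsSubgraph G) (S : Finset V)
    {φ ψ : Finset (V × V)} (hφ : φ ⊆ ψ) :
    (H.activated φ S).card ≤ (G.activated ψ S).card := by
  refine Finset.card_le_card fun v hv => ?_
  rw [mem_activated] at hv ⊢
  obtain ⟨hv, s, hs, hr⟩ := hv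
  exact ⟨h.nodes_subset hv, s, hs, Relation.ReflTransGen.mono (fun _ _ he => hφ he) _ _ hr⟩

variable [DecidableEq V]

theorem expect_realizationPMF (G : ProbGraph V) (f : Finset (V × V) → ℝ≥0∞) :
    G.realizationPMF.expect f =
      ∑ φ ∈ G.edges.powerset, ENNReal.ofReal (G.realizationProb φ) * f φ := by
  have key : ∀ φ, G.realizationPMF φ =
      if φ ∈ G.edges.powerset then ENNReal.ofReal (G.realizationProb φ) else 0 := fun _ => rfl
  rw [PMF.expect, tsum_eq_sum (s := G.edges.powerset) fun φ hφ => by rw [key, if_neg hφ, zero_mul]]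
  exact Finset.sum_congr rfl fun φ hφ => by rw [key, if_pos hφ]

theorem expect_card_activated (G : ProbGraph V) (S : Finset V) :
    (G.realizationPMF.expect fun φ => ((G.activated φ S).card : ℝ≥0∞)) =
      ENNReal.ofReal (G.expectedSpread S) := by
  rw [expect_realizationPMF, expectedSpread, ENNReal.ofReal_sum_of_nonneg fun φ hφ =>
    mul_nonneg (Nat.cast_nonneg _) (G.realizationProb_nonneg hφ)]
  refine Finset.sum_congr rfl fun φ hφ => ?_
  rw [mul_comm, ENNReal.ofReal_mul (Nat.cast_nonneg _), ENNReal.ofReal_natCast]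

theorem IsSubgraph.remove {H G : ProbGraph V} (h : H.IsSubgraph G) (A : Finset V) :
    (H.remove A).IsSubgraph G :=
  ⟨Finset.sdiff_subset.trans h.nodes_subset, (Finset.filter_subset _ _).trans h.edges_subset,
    h.prob_eq⟩

/-- Extra independent coins can only enlarge the random set, so they can only raise the mean of a
monotone function. The induction conditions on one coin at a time. -/
theorem sum_powerset_bernoulli_mono {α : Type*} [DecidableEq α] (p : α → ℝ)
    (f : Finset α → ℝ) (hf : Monotone f) {s t : Finset α} (hst : s ⊆ t)
    (hp : ∀ a ∈ t, 0 ≤ p a ∧ p a ≤ 1) :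
    ∑ φ ∈ s.powerset, f φ * ((∏ a ∈ φ, p a) * ∏ a ∈ s \ φ, (1 - p a)) ≤
      ∑ φ ∈ t.powerset, f φ * ((∏ a ∈ φ, p a) * ∏ a ∈ t \ φ, (1 - p a)) := by
  induction t using Finset.induction_on generalizing s f with
  | empty => rw [Finset.subset_empty.1 hst]
  | insert a t ha ih =>
    have hpt : ∀ b ∈ t, 0 ≤ p b ∧ p b ≤ 1 := fun b hb => hp b (Finset.mem_insert_of_mem hb)
    have hpa := hp a (Finset.mem_insert_self _ _)
    -- Conditioning on the coin of `a` replaces `g` by its average over the two outcomes.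
    have expand : ∀ (g : Finset α → ℝ) (r : Finset α), a ∉ r →
        ∑ φ ∈ (insert a r).powerset, g φ * ((∏ b ∈ φ, p b) * ∏ b ∈ insert a r \ φ, (1 - p b)) =
          ∑ φ ∈ r.powerset, ((1 - p a) * g φ + p a * g (insert a φ)) *
            ((∏ b ∈ φ, p b) * ∏ b ∈ r \ φ, (1 - p b)) := by
      intro g r hr
      rw [Finset.sum_powerset_insert hr, ← Finset.sum_add_distrib]
      refine Finset.sum_congr rfl fun φ hφ => ?_
      have hφa : a ∉ φ := fun h => hr (Finset.mem_powerset.1 hφ h)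
      rw [Finset.insert_sdiff_of_notMem _ hφa, Finset.insert_sdiff_insert,
        Finset.sdiff_insert_of_notMem hr, Finset.prod_insert hφa,
        Finset.prod_insert fun h => hr (Finset.mem_sdiff.1 h).1]
      ring
    have weight_nonneg : ∀ φ ∈ t.powerset, 0 ≤ (∏ b ∈ φ, p b) * ∏ b ∈ t \ φ, (1 - p b) := by
      intro φ hφ
      rw [Finset.mem_powerset] at hφ
      exact mul_nonneg (Finset.prod_nonneg fun b hb => (hpt b (hφ hb)).1)
        (Finset.prod_nonneg fun b hb => sub_nonneg.2 (hpt b (Finset.mem_sdiff.1 hb).1).2)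
    by_cases has : a ∈ s
    · obtain ⟨r, hr, rfl⟩ : ∃ r, a ∉ r ∧ insert a r = s :=
        ⟨s.erase a, Finset.notMem_erase _ _, Finset.insert_erase has⟩
      have hrt : r ⊆ t := fun b hb =>
        (Finset.mem_insert.1 (hst (Finset.mem_insert_of_mem hb))).resolve_left fun h => hr (h ▸ hb)
      rw [expand f r hr, expand f t ha]
      -- When both sides toss the coin of `a`, the averaged function is again monotone and the
      -- induction hypothesis applies to it; this is why `f` is generalized.
      have hmono : Monotone fun φ => (1 - p a) * f φ + p a * f (insert a φ) := fun x y hxy =>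
        add_le_add (mul_le_mul_of_nonneg_left (hf hxy) (sub_nonneg.2 hpa.2))
          (mul_le_mul_of_nonneg_left (hf (Finset.insert_subset_insert a hxy)) hpa.1)
      exact ih _ hmono hrt hpt
    · have hs' : s ⊆ t := fun b hb => (Finset.mem_insert.1 (hst hb)).resolve_left
        fun h => has (h ▸ hb)
      rw [expand f t ha]
      refine (ih f hf hs' hpt).trans (Finset.sum_le_sum fun φ hφ => ?_)
      refine mul_le_mul_of_nonneg_right ?_ (weight_nonneg φ hφ)
      have := mul_le_mul_of_nonneg_left (hf (Finset.subset_insert a φ)) hpa.1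
      linarith

end ProbGraph

namespace ProbGraph

variable {V : Type*} [DecidableEq V]

/-- Two enlargements: first the node set, with the live edges unchanged, then the set of edges that
toss a coin. -/
theorem IsSubgraph.expectedSpread_le {H G : ProbGraph V} (h : H.IsSubgraph G) (S : Finset V) :
    H.expectedSpread S ≤ G.expectedSpread S := by
  calc H.expectedSpread S
      ≤ ∑ φ ∈ H.edges.powerset, ((G.activated φ S).card : ℝ) * H.realizationProb φ := by
        refine Finset.sum_le_sum fun φ hφ =>
          mul_le_mul_of_nonneg_right ?_ (H.realizationProb_nonneg hφ)
        exact_mod_cast activated_card_mono h S subset_rfl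
    _ ≤ G.expectedSpread S := by
        simp only [expectedSpread, realizationProb, h.prob_eq]
        refine sum_powerset_bernoulli_mono G.prob (fun φ => ((G.activated φ S).card : ℝ))
          (fun φ ψ hφ => ?_) h.edges_subset fun e he => ⟨(G.prob_pos e he).le, G.prob_le_one e he⟩
        exact Nat.cast_le.2 (activated_card_mono (IsSubgraph.refl G) S hφ)

theorem one_le_expectedSpread (G : ProbGraph V) {v : V} (hv : v ∈ G.nodes) :
    1 ≤ G.expectedSpread {v} := by
  rw [← G.sum_realizationProb]
  refine Finset.sum_le_sum fun φ hφ => le_mul_of_one_le_left (G.realizationProb_nonneg hφ) ?_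
  have : v ∈ G.activated φ {v} := (G.mem_activated_singleton φ v v).2 ⟨hv, .refl⟩
  exact_mod_cast Finset.card_pos.2 ⟨v, this⟩

/-! ## The cost of a random RR set -/

/-- The edges counted so far are charged to heads that have already left the frontier. A node is
never in the frontier twice, so no edge is counted twice. -/
theorem rrStep_invariant (G : ProbGraph V) {φ : Finset (V × V)} (hφ : φ ⊆ G.edges) {v : V}
    {s : RRSearch V}
    (hv : ∀ x ∈ s.visited, x ∈ G.nodes ∧ Relation.ReflTransGen (fun a b => (a, b) ∈ φ) x v)
    (hf : s.frontier ⊆ s.visited)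
    (he : s.examined ≤ (G.edges.filter fun e => e.2 ∈ s.visited \ s.frontier).card) :
    (∀ x ∈ (G.rrStep φ s).visited,
        x ∈ G.nodes ∧ Relation.ReflTransGen (fun a b => (a, b) ∈ φ) x v) ∧
      (G.rrStep φ s).frontier ⊆ (G.rrStep φ s).visited ∧
      (G.rrStep φ s).examined ≤ (G.edges.filter fun e =>
        e.2 ∈ (G.rrStep φ s).visited \ (G.rrStep φ s).frontier).card := by
  refine ⟨fun x hx => ?_, fun x hx => ?_, ?_⟩
  · simp only [rrStep, Finset.mem_union, Finset.mem_image, Finset.mem_filter] at hx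
    obtain hx | ⟨e, ⟨heφ, hef⟩, rfl⟩ := hx
    · exact hv x hx
    · exact ⟨G.src_mem e (hφ heφ), (hv e.2 (hf hef)).2.head heφ⟩
  · simp only [rrStep] at hx ⊢
    exact Finset.mem_union_right _ (Finset.mem_sdiff.1 hx).1
  · have hdisj : Disjoint (G.edges.filter fun e => e.2 ∈ s.visited \ s.frontier)
        (G.edges.filter fun e => e.2 ∈ s.frontier) := by
      rw [Finset.disjoint_filter]
      exact fun e _ h => (Finset.mem_sdiff.1 h).2
    calc (G.rrStep φ s).examined
        ≤ ((G.edges.filter fun e => e.2 ∈ s.visited \ s.frontier) ∪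
            G.edges.filter fun e => e.2 ∈ s.frontier).card := by
          rw [Finset.card_union_of_disjoint hdisj]
          exact Nat.add_le_add_right he _
      _ ≤ _ := by
          -- The new frontier avoids the old visited set, so every old visited node is now behind
          -- the frontier.
          refine Finset.card_le_card fun e h => ?_
          have hE : e ∈ G.edges ∧ e.2 ∈ s.visited := by
            rw [Finset.mem_union, Finset.mem_filter, Finset.mem_filter, Finset.mem_sdiff] at h
            exact h.elim (fun h => ⟨h.1, h.2.1⟩) fun h => ⟨h.1, hf h.2⟩
          simp only [rrStep, Finset.mem_filter, Finset.mem_sdiff, Finset.mem_union]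
          exact ⟨hE.1, .inl hE.2, fun h => h.2 hE.2⟩

/-- Upper bounds suffice for the cost, so it is not needed that the search finds every node that
reaches `v`. -/
theorem rrSearch_bounds (G : ProbGraph V) {φ : Finset (V × V)} (hφ : φ ⊆ G.edges) {v : V}
    (hv : v ∈ G.nodes) :
    (G.rrSearch φ v).visited.card ≤ (G.nodes.filter fun x => v ∈ G.activated φ {x}).card ∧
      (G.rrSearch φ v).examined ≤ (G.edges.filter fun e => v ∈ G.activated φ {e.2}).card := by
  have key : ∀ j : ℕ,
      (∀ x ∈ ((G.rrStep φ)^[j] ⟨{v}, {v}, 0⟩).visited,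
        x ∈ G.nodes ∧ Relation.ReflTransGen (fun a b => (a, b) ∈ φ) x v) ∧
      ((G.rrStep φ)^[j] ⟨{v}, {v}, 0⟩).frontier ⊆ ((G.rrStep φ)^[j] ⟨{v}, {v}, 0⟩).visited ∧
      ((G.rrStep φ)^[j] ⟨{v}, {v}, 0⟩).examined ≤ (G.edges.filter fun e =>
        e.2 ∈ ((G.rrStep φ)^[j] ⟨{v}, {v}, 0⟩).visited \
          ((G.rrStep φ)^[j] ⟨{v}, {v}, 0⟩).frontier).card := by
    intro j
    induction j with
    | zero =>
      refine ⟨fun x hx => ?_, subset_rfl, Nat.zero_le _⟩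
      obtain rfl : x = v := by simpa using hx
      exact ⟨hv, .refl⟩
    | succ j ih =>
      rw [Function.iterate_succ_apply']
      exact G.rrStep_invariant hφ ih.1 ih.2.1 ih.2.2
  obtain ⟨h1, -, h3⟩ := key G.n
  refine ⟨Finset.card_le_card fun x hx => ?_, h3.trans (Finset.card_le_card fun e he => ?_)⟩
  · have := h1 x hx
    exact Finset.mem_filter.2 ⟨this.1, (G.mem_activated_singleton φ x v).2 ⟨hv, this.2⟩⟩
  · rw [Finset.mem_filter, Finset.mem_sdiff] at he
    exact Finset.mem_filter.2
      ⟨he.1, (G.mem_activated_singleton φ e.2 v).2 ⟨hv, (h1 e.2 he.2.1).2⟩⟩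

theorem sum_card_filter_activated (G : ProbGraph V) (φ : Finset (V × V)) {α : Type*}
    (s : Finset α) (f : α → V) :
    ∑ v ∈ G.nodes, (s.filter fun x => v ∈ G.activated φ {f x}).card =
      ∑ x ∈ s, (G.activated φ {f x}).card := by
  simp only [Finset.card_filter]
  rw [Finset.sum_comm]
  refine Finset.sum_congr rfl fun x _ => ?_
  rw [← Finset.card_filter]
  congr 1
  ext v
  rw [Finset.mem_filter, mem_activated, and_self_left]

/-- The factor `n` cancels the uniform choice of the root; double counting the pairs of an item `x`
and a root reached from `f x` then gives spreads. The items are edges with their heads for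
examinations, and the nodes themselves for the size of the RR set. -/
theorem expect_rrPMF_le (G : ProbGraph V) (hG : G.nodes.Nonempty) (cost : RRSearch V → ℕ)
    {α : Type*} (s : Finset α) (f : α → V) (hf : ∀ x ∈ s, f x ∈ G.nodes)
    (hcost : ∀ φ ⊆ G.edges, ∀ v ∈ G.nodes,
      cost (G.rrSearch φ v) ≤ (s.filter fun x => v ∈ G.activated φ {f x}).card)
    {I : ℝ} (hI : ∀ v ∈ G.nodes, G.expectedSpread {v} ≤ I) :
    (G.n : ℝ≥0∞) * (G.rrPMF hG).expect (fun r => (cost r : ℝ≥0∞)) ≤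
      s.card * ENNReal.ofReal I := by
  have hle : ∀ v ∈ G.nodes,
      (G.realizationPMF.expect fun φ => (cost (G.rrSearch φ v) : ℝ≥0∞)) ≤
        ∑ φ ∈ G.edges.powerset, ENNReal.ofReal (G.realizationProb φ) *
          ((s.filter fun x => v ∈ G.activated φ {f x}).card : ℝ≥0∞) := by
    intro v hv
    rw [expect_realizationPMF]
    refine Finset.sum_le_sum fun φ hφ => mul_le_mul_right ?_ _
    exact_mod_cast hcost φ (Finset.mem_powerset.1 hφ) v hv
  rw [rrPMF, PMF.expect_bind, n, PMF.expect_uniformOfFinset]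
  simp only [PMF.expect_map]
  refine (Finset.sum_le_sum hle).trans ?_
  rw [Finset.sum_comm]
  calc _ = ∑ φ ∈ G.edges.powerset, ENNReal.ofReal (G.realizationProb φ) *
        ∑ x ∈ s, ((G.activated φ {f x}).card : ℝ≥0∞) := by
        refine Finset.sum_congr rfl fun φ _ => ?_
        rw [← Finset.mul_sum]
        congr 1
        exact_mod_cast G.sum_card_filter_activated φ s f
    _ = ∑ x ∈ s, ENNReal.ofReal (G.expectedSpread {f x}) := by
        simp only [Finset.mul_sum]
        rw [Finset.sum_comm]
        simp only [← expect_realizationPMF, expect_card_activated]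
    _ ≤ _ := by
        rw [← nsmul_eq_mul]
        exact Finset.sum_le_card_nsmul _ _ _ fun x hx => ENNReal.ofReal_le_ofReal (hI _ (hf x hx))

/-- The expected time that one RR set takes. -/
noncomputable def rrCost (w : ℕ) (G : ProbGraph V) (hG : G.nodes.Nonempty) : ℝ≥0∞ :=
  (G.rrPMF hG).expect fun r => ((r.examined + w * (1 + 2 * r.visited.card) : ℕ) : ℝ≥0∞)

theorem mul_rrCost_le (w : ℕ) (G : ProbGraph V) (hG : G.nodes.Nonempty) {I : ℝ}
    (hI : ∀ v ∈ G.nodes, G.expectedSpread {v} ≤ I) :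
    (G.n : ℝ≥0∞) * G.rrCost w hG ≤
      G.m * ENNReal.ofReal I + w * (G.n + 2 * (G.n * ENNReal.ofReal I)) := by
  have h1 := G.expect_rrPMF_le hG RRSearch.examined G.edges Prod.snd G.tgt_mem
    (fun φ hφ v hv => (G.rrSearch_bounds hφ hv).2) hI
  have h2 := G.expect_rrPMF_le hG (fun r => r.visited.card) G.nodes id (fun x hx => hx)
    (fun φ hφ v hv => (G.rrSearch_bounds hφ hv).1) hI
  simp only [rrCost, Nat.cast_add, Nat.cast_mul, Nat.cast_one, Nat.cast_ofNat, PMF.expect_add,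
    PMF.expect_const_mul, PMF.expect_const]
  calc _ = (G.n : ℝ≥0∞) * (G.rrPMF hG).expect (fun r => (r.examined : ℝ≥0∞)) +
        w * (G.n + 2 * (G.n * (G.rrPMF hG).expect fun r => (r.visited.card : ℝ≥0∞))) := by ring
    _ ≤ _ := add_le_add h1 (mul_le_mul_right (add_le_add_right (mul_le_mul_right h2 _) _) _)

end ProbGraph

/-! ## The running time of AddATP -/

namespace AddATP

open ProbGraph

variable {V : Type*} [DecidableEq V]

theorem one_le_sampleSize {ζ δ : ℝ} (hζ : 0 < ζ) (hδ : 0 < δ) (hδ1 : δ ≤ 1) :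
    1 ≤ sampleSize ζ δ :=
  Nat.one_le_iff_ne_zero.2 (Nat.ceil_pos.2 (mul_pos (by positivity)
    (Real.log_pos (by rw [lt_div_iff₀ hδ]; linarith)))).ne'

/-- The factor 1/2 in the sample size leaves room for the rounding: the ceiling adds at most 1, and
`L / (2 * ζ ^ 2)` is at least 1. -/
theorem sampleSize_le {ζ δ L : ℝ} (hζ : 0 < ζ) (hζ1 : ζ ≤ 1) (hδ : 0 < δ) (hδ1 : δ ≤ 1)
    (hL : 2 ≤ L) (hlog : Real.log (8 / δ) ≤ L) : (sampleSize ζ δ : ℝ) ≤ L * (1 / ζ ^ 2) := by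
  have hlog0 : 0 ≤ Real.log (8 / δ) := Real.log_nonneg (by rw [le_div_iff₀ hδ]; linarith)
  have hz : 1 ≤ 1 / ζ ^ 2 := by
    rw [le_div_iff₀ (by positivity)]
    nlinarith
  have e : 1 / (2 * ζ ^ 2) = 1 / ζ ^ 2 / 2 := by field_simp
  have h := Nat.ceil_lt_add_one (mul_nonneg (by positivity : 0 ≤ 1 / (2 * ζ ^ 2)) hlog0)
  rw [sampleSize]
  rw [e] at h ⊢
  generalize 1 / ζ ^ 2 = z at *
  have : z / 2 * Real.log (8 / δ) ≤ z / 2 * L := mul_le_mul_of_nonneg_left hlog (by linarith)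
  nlinarith

theorem expect_samplingTime (w : ℕ) (G : ProbGraph V) (hG : G.nodes.Nonempty) (θ : ℕ) :
    ((iid (G.rrPMF hG) θ).expect fun R => (samplingTime w R : ℝ≥0∞)) = θ * G.rrCost w hG :=
  expect_iid_sum _ _ _

/-- One round costs `w` and two collections of RR sets, and the next round takes place only if
`C₂` fails. -/
theorem expect_loop_le_of_next (w : ℕ) (G : ProbGraph V) (hG : G.nodes.Nonempty) (u : V) (cu : ℝ)
    (S T : Finset V) (ζ δ : ℝ) {c : ℝ≥0∞}
    (hc : 1 < G.n * ζ → ((loop w G hG u cu S T (ζ / √2) (δ / 2)).expect fun r => (r.2 : ℝ≥0∞)) ≤ c) :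
    ((loop w G hG u cu S T ζ δ).expect fun r => (r.2 : ℝ≥0∞)) ≤
      w + 2 * sampleSize ζ δ * G.rrCost w hG + c := by
  rw [loop, PMF.expect_bind]
  simp only [PMF.expect_bind]
  calc _ ≤ (iid (G.rrPMF hG) (sampleSize ζ δ)).expect fun R₁ =>
        (iid (G.rrPMF hG) (sampleSize ζ δ)).expect fun R₂ =>
          ((w : ℝ≥0∞) + samplingTime w R₁ + samplingTime w R₂ + c) := by
        refine PMF.expect_mono _ fun R₁ => PMF.expect_mono _ fun R₂ => ?_
        split_ifs with h
        · rw [PMF.expect_pure]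
          push_cast
          exact le_self_add
        · rw [PMF.expect_map]
          simp only [Nat.cast_add, PMF.expect_add, PMF.expect_const]
          gcongr
          exact hc (not_le.1 fun h' => h (.inr h'))
    _ = _ := by
        simp only [PMF.expect_add, PMF.expect_const, expect_samplingTime]
        ring

/-- With `z = 1 / ζ ^ 2`, the maximum of `4 n ^ 2 - z` and `z` is a potential that pays for the
current round and all later ones. Since `δ` and `ζ ^ 2` are halved together, `δ / ζ ^ 2` keeps its
value `b`, so one `L` bounds the logarithms of all rounds. The induction uses the termination
measure of the loop. -/
theorem expect_loop_le (w : ℕ) (G : ProbGraph V) (hG : G.nodes.Nonempty) (u : V) (cu : ℝ)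
    (S T : Finset V) {b L : ℝ} (hb : 0 < b) (hL : 2 ≤ L)
    (hbL : Real.log (16 * (G.n : ℝ) ^ 2 / b) ≤ L) {ζ δ : ℝ} (hζ : 0 < ζ) (hζ1 : ζ ≤ 1)
    (hδ : δ = b * ζ ^ 2) (hδ1 : δ ≤ 1) (hlog : Real.log (8 / δ) ≤ L) :
    ((loop w G hG u cu S T ζ δ).expect fun r => (r.2 : ℝ≥0∞)) ≤
      (w + 2 * G.rrCost w hG) *
        ENNReal.ofReal (L * max (4 * (G.n : ℝ) ^ 2 - 1 / ζ ^ 2) (1 / ζ ^ 2)) := by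
  induction hk : ⌈((G.n : ℝ) * ζ) ^ 2⌉₊ using Nat.strong_induction_on generalizing ζ δ with
  | _ k ih =>
  have hδ0 : 0 < δ := by rw [hδ]; positivity
  have h2 : (√2 : ℝ) ^ 2 = 2 := Real.sq_sqrt (by norm_num)
  have hθ := sampleSize_le hζ hζ1 hδ0 hδ1 hL hlog
  have hround : (w : ℝ≥0∞) + 2 * sampleSize ζ δ * G.rrCost w hG ≤
      (w + 2 * G.rrCost w hG) * ENNReal.ofReal (L * (1 / ζ ^ 2)) := by
    -- At least one RR set is drawn, so the overhead `w` of the round can be charged to the samples.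
    have h1 : (1 : ℝ≥0∞) ≤ sampleSize ζ δ := by exact_mod_cast one_le_sampleSize hζ hδ0 hδ1
    calc (w : ℝ≥0∞) + 2 * sampleSize ζ δ * G.rrCost w hG
        ≤ w * sampleSize ζ δ + 2 * sampleSize ζ δ * G.rrCost w hG := by
          gcongr
          exact le_mul_of_one_le_right' h1
      _ = (w + 2 * G.rrCost w hG) * sampleSize ζ δ := by ring
      _ ≤ _ := by
          gcongr
          rw [← ENNReal.ofReal_natCast]
          exact ENNReal.ofReal_le_ofReal hθ
  by_cases hn : 1 < G.n * ζ
  · have hnz : 1 / ζ ^ 2 < (G.n : ℝ) ^ 2 := by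
      rw [div_lt_iff₀ (by positivity), ← mul_pow]
      exact one_lt_pow₀ hn two_ne_zero
    have hz : 1 / (ζ / √2) ^ 2 = 2 * (1 / ζ ^ 2) := by
      rw [div_pow, h2]
      field_simp
    have hnext := ih _ (hk ▸ ceil_sq_lt hn) (ζ := ζ / √2) (δ := δ / 2) (by positivity)
      ((div_le_self hζ.le (Real.one_le_sqrt.2 (by norm_num))).trans hζ1)
      (by rw [div_pow, h2, hδ]; ring) (by linarith)
      (by
        -- The next round takes place only if `1 / ζ ^ 2 < n ^ 2`, which bounds its `8 / δ` by `16 n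
        -- ^ 2 / b`.
        refine (Real.log_le_log (by positivity) ?_).trans hbL
        rw [hδ, show 8 / (b * ζ ^ 2 / 2) = 16 * (1 / ζ ^ 2) / b by field_simp; norm_num]
        gcongr) rfl
    rw [hz] at hnext
    refine (expect_loop_le_of_next w G hG u cu S T ζ δ fun _ => hnext).trans ?_
    refine (add_le_add_left hround _).trans ?_
    have hz0 : 0 ≤ 1 / ζ ^ 2 := by positivity
    rw [← mul_add, ← ENNReal.ofReal_add (by positivity)
      (mul_nonneg (by linarith) (le_max_of_le_right (by linarith))), ← mul_add]
    refine mul_le_mul_right (ENNReal.ofReal_le_ofReal (mul_le_mul_of_nonneg_left ?_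
      (by linarith))) _
    generalize 1 / ζ ^ 2 = z at *
    -- The potential decreases enough: `z + (4 n ^ 2 - 2 z) = 4 n ^ 2 - z`, and `z + 2 z ≤ 4 n ^ 2 -
    -- z` because `z < n ^ 2`.
    refine le_max_of_le_left ?_
    rcases max_cases (4 * (G.n : ℝ) ^ 2 - 2 * z) (2 * z) with h | h <;> linarith [h.1]
  · refine (expect_loop_le_of_next w G hG u cu S T ζ δ (c := 0) fun h => absurd h hn).trans ?_
    rw [add_zero]
    refine hround.trans (mul_le_mul_right (ENNReal.ofReal_le_ofReal ?_) _)
    exact mul_le_mul_of_nonneg_left (le_max_right _ _) (by linarith)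

/-- Every residual graph is a subgraph of `G`, whatever `Φ` and the earlier decisions are, so one
uniform `B` bounds each iteration. The update cost is charged even when `u` is rejected; `hw` covers
nodes that are already activated. -/
theorem expect_iterations_le (w : ℕ) (c : V → ℝ) (ζ₀ : ℕ → ℝ) (δ₀ : ℝ) (Φ : Finset (V × V))
    (G : ProbGraph V) {B : ℝ≥0∞} (hw : w ≤ B)
    (hB : ∀ H : ProbGraph V, H.IsSubgraph G → ∀ (hH : H.nodes.Nonempty) (u : V) (S T : Finset V),
      w + ((loop w H hH u (c u) S T (ζ₀ H.n) δ₀).expect fun r => (r.2 : ℝ≥0∞)) +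
        w * (H.n + H.m) ≤ B)
    (us : List V) (s : State V) (hs : s.graph.IsSubgraph G) :
    ((iterations w c ζ₀ δ₀ Φ us s).expect fun s' => (s'.time : ℝ≥0∞)) ≤
      s.time + us.length * B := by
  induction us generalizing s with
  | nil => simp [iterations, PMF.expect_pure]
  | cons u us ih =>
    have hlen : (s.time : ℝ≥0∞) + (u :: us).length * B = s.time + B + us.length * B := by
      push_cast [List.length_cons]
      ring
    rw [iterations, PMF.expect_bind, iteration, hlen]
    split_ifs with h
    · rw [PMF.expect_map]
      calc _ ≤ (loop w s.graph ⟨u, h⟩ u (c u) s.S s.T (ζ₀ s.graph.n) δ₀).expect fun r =>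
            (s.time : ℝ≥0∞) + w + r.2 + w * (s.graph.n + s.graph.m) + us.length * B := by
            refine PMF.expect_mono _ fun r => ?_
            split_ifs with hr
            · refine (ih _ (hs.remove _)).trans (le_of_eq ?_)
              push_cast
              rfl
            · refine (ih { s with T := s.T.erase u, time := s.time + w + r.2 } hs).trans ?_
              push_cast
              exact add_le_add_left le_self_add _
        _ = s.time + (w + ((loop w s.graph ⟨u, h⟩ u (c u) s.S s.T (ζ₀ s.graph.n) δ₀).expect
              fun r => (r.2 : ℝ≥0∞)) + w * (s.graph.n + s.graph.m)) + us.length * B := by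
            simp only [PMF.expect_add, PMF.expect_const]
            ring
        _ ≤ _ := by
            gcongr
            exact hB _ hs _ _ _ _
    · rw [PMF.expect_pure]
      refine (ih { s with T := s.T.erase u, time := s.time + w } hs).trans ?_
      push_cast
      gcongr

theorem expectedTime_le (w : ℕ) (G : ProbGraph V) (us : List V) (c : V → ℝ) (ζ₀ : ℕ → ℝ)
    {B : ℝ≥0∞} (hw : w ≤ B)
    (hB : ∀ H : ProbGraph V, H.IsSubgraph G → ∀ (hH : H.nodes.Nonempty) (u : V) (S T : Finset V),
      w + ((loop w H hH u (c u) S T (ζ₀ H.n) (1 / ((us.length : ℝ) * G.n))).expect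
        fun r => (r.2 : ℝ≥0∞)) + w * (H.n + H.m) ≤ B) :
    expectedTime w G us c ζ₀ ≤ us.length * B := by
  change (run w G us c ζ₀).expect (fun s => (s.time : ℝ≥0∞)) ≤ _
  rw [run, PMF.expect_bind]
  refine (PMF.expect_mono _ fun Φ =>
    expect_iterations_le w c ζ₀ _ Φ G hw hB us _ (IsSubgraph.refl G)).trans ?_
  rw [PMF.expect_const]
  simp

/-- The bound for one iteration in which the residual graph is `H`, a part of `G`. -/
theorem expect_loop_le_of_isSubgraph (w : ℕ) {G H : ProbGraph V} (hHG : H.IsSubgraph G)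
    (hH : H.nodes.Nonempty) (u : V) (cu : ℝ) (S T : Finset V) {κ ζ I : ℝ} {k : ℕ} (hκ : 0 < κ)
    (hn : 2 ≤ G.n) (hk : 1 ≤ k) (hkn : k ≤ G.n) (hζ : κ / H.n ≤ ζ) (hζ1 : ζ ≤ 1)
    (hI : ∀ v ∈ G.nodes, G.expectedSpread {v} ≤ I) :
    ((loop w H hH u cu S T ζ (1 / ((k : ℝ) * G.n))).expect fun r => (r.2 : ℝ≥0∞)) ≤
      ENNReal.ofReal (8 * Real.log G.n * (4 + 1 / κ ^ 2) * G.n *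
        (w * G.n + 2 * (G.m * I + w * (G.n + 2 * (G.n * I))))) := by
  have hN : 0 < (H.n : ℝ) := Nat.cast_pos.2 hH.card_pos
  have hN1 : 1 ≤ (H.n : ℝ) := Nat.one_le_cast.2 hH.card_pos
  have hNn : (H.n : ℝ) ≤ G.n := Nat.cast_le.2 (Finset.card_le_card hHG.nodes_subset)
  have hMm : (H.m : ℝ) ≤ G.m := Nat.cast_le.2 (Finset.card_le_card hHG.edges_subset)
  have hn' : (2 : ℝ) ≤ G.n := by exact_mod_cast hn
  have hk' : (1 : ℝ) ≤ k := by exact_mod_cast hk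
  have hkn' : (k : ℝ) ≤ G.n := by exact_mod_cast hkn
  have hζ0 : 0 < ζ := lt_of_lt_of_le (by positivity) hζ
  have hIH : ∀ v ∈ H.nodes, H.expectedSpread {v} ≤ I := fun v hv =>
    (hHG.expectedSpread_le _).trans (hI v (hHG.nodes_subset hv))
  have hI0 : 0 ≤ I := by
    obtain ⟨v, hv⟩ := hH
    linarith [hIH v hv, H.one_le_expectedSpread hv]
  have hlog2 : 0.6931471803 < Real.log 2 := Real.log_two_gt_d9
  have hlogn : Real.log 2 ≤ Real.log G.n := Real.log_le_log (by norm_num) hn'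
  have hlog0 : 0 < Real.log G.n := by linarith
  have hδ1 : 1 / ((k : ℝ) * G.n) ≤ 1 := by
    rw [div_le_one (by positivity)]
    nlinarith
  -- The 8 comes from `16 n ^ 4 ≤ n ^ 8` for `n ≥ 2`.
  have hpow : ∀ x : ℝ, 0 < x → x ≤ 16 * (G.n : ℝ) ^ 4 → Real.log x ≤ 8 * Real.log G.n := by
    intro x hx h
    have h8 : 8 * Real.log (G.n : ℝ) = Real.log ((G.n : ℝ) ^ 8) := by
      rw [Real.log_pow]
      norm_num
    rw [h8]
    refine Real.log_le_log hx (h.trans ?_)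
    have : (2 : ℝ) ^ 4 ≤ (G.n : ℝ) ^ 4 := by gcongr
    nlinarith [pow_pos (by linarith : (0 : ℝ) < G.n) 4]
  have hkn2 : (k : ℝ) * G.n ≤ (G.n : ℝ) ^ 2 := by
    rw [sq]
    gcongr
  have h1 := expect_loop_le w H hH u cu S T (b := 1 / ((k : ℝ) * G.n) / ζ ^ 2)
    (L := 8 * Real.log G.n) (δ := 1 / ((k : ℝ) * G.n)) (by positivity) (by linarith)
    (by
      refine hpow _ (by positivity) ?_
      calc 16 * (H.n : ℝ) ^ 2 / (1 / ((k : ℝ) * G.n) / ζ ^ 2)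
          = 16 * (H.n : ℝ) ^ 2 * (k * G.n) * ζ ^ 2 := by field_simp
        _ ≤ 16 * (G.n : ℝ) ^ 2 * (G.n : ℝ) ^ 2 * 1 ^ 2 := by gcongr
        _ = 16 * (G.n : ℝ) ^ 4 := by ring)
    hζ0 hζ1 (by field_simp) hδ1
    (by
      refine hpow _ (by positivity) ?_
      calc 8 / (1 / ((k : ℝ) * G.n)) = 8 * 1 * (k * G.n) := by field_simp
        _ ≤ 16 * (G.n : ℝ) ^ 2 * (G.n : ℝ) ^ 2 := by
            gcongr
            · norm_num
            · nlinarith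
        _ = 16 * (G.n : ℝ) ^ 4 := by ring)
  have hz : 1 / ζ ^ 2 ≤ 1 / κ ^ 2 * (H.n : ℝ) ^ 2 := by
    calc 1 / ζ ^ 2 ≤ 1 / (κ / H.n) ^ 2 := by gcongr
      _ = 1 / κ ^ 2 * (H.n : ℝ) ^ 2 := by field_simp
  -- Only one of the two factors `H.n` is enlarged to `G.n`; the other is kept to multiply `rrCost`.
  have hmax : max (4 * (H.n : ℝ) ^ 2 - 1 / ζ ^ 2) (1 / ζ ^ 2) ≤
      (4 + 1 / κ ^ 2) * G.n * H.n := by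
    have : max (4 * (H.n : ℝ) ^ 2 - 1 / ζ ^ 2) (1 / ζ ^ 2) ≤ (4 + 1 / κ ^ 2) * H.n * H.n := by
      have h3 : 0 ≤ 1 / κ ^ 2 * (H.n : ℝ) ^ 2 := by positivity
      have h4 : 0 ≤ 1 / ζ ^ 2 := by positivity
      refine max_le ?_ ?_ <;> nlinarith
    refine this.trans ?_
    gcongr
  have hcost := H.mul_rrCost_le w hH hIH
  calc _ ≤ (w + 2 * H.rrCost w hH) *
        ENNReal.ofReal (8 * Real.log G.n * ((4 + 1 / κ ^ 2) * G.n * H.n)) := by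
        refine h1.trans ?_
        gcongr
    _ = ENNReal.ofReal (8 * Real.log G.n * (4 + 1 / κ ^ 2) * G.n) *
        (w * H.n + 2 * (H.n * H.rrCost w hH)) := by
        rw [← mul_assoc, ← mul_assoc, ENNReal.ofReal_mul (by positivity), ENNReal.ofReal_natCast]
        ring
    _ ≤ ENNReal.ofReal (8 * Real.log G.n * (4 + 1 / κ ^ 2) * G.n) *
        (w * H.n + 2 * (H.m * ENNReal.ofReal I + w * (H.n + 2 * (H.n * ENNReal.ofReal I)))) := by
        gcongr
    _ = ENNReal.ofReal (8 * Real.log G.n * (4 + 1 / κ ^ 2) * G.n) *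
        ENNReal.ofReal (w * H.n + 2 * (H.m * I + w * (H.n + 2 * (H.n * I)))) := by
        congr 1
        simp only [← ENNReal.ofReal_natCast, ← ENNReal.ofReal_ofNat]
        repeat' first
          | rw [ENNReal.ofReal_add (by positivity) (by positivity)]
          | rw [ENNReal.ofReal_mul (by positivity)]
    _ ≤ _ := by
        rw [← ENNReal.ofReal_mul (by positivity)]
        gcongr

end AddATP

/-! ### The two final bounds and their common constant -/

theorem mainTheorem5 (κ : ℝ) (hκ : 0 < κ) :
    ∃ C : ℝ, 0 < C ∧
      ∀ (V : Type*) [DecidableEq V] (G : ProbGraph V) (us : List V) (c : V → ℝ) (ζ₀ : ℕ → ℝ)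
        (v₀ : V),
        2 ≤ G.n → us.Nodup → (∀ u ∈ us, u ∈ G.nodes) →
        (∀ r : ℕ, 1 ≤ r → r ≤ G.n → κ / r ≤ ζ₀ r ∧ ζ₀ r ≤ 1) →
        v₀ ∈ G.nodes → (∀ v ∈ G.nodes, G.expectedSpread {v} ≤ G.expectedSpread {v₀}) →
        AddATP.expectedTime 0 G us c ζ₀ ≤
            ENNReal.ofReal (C * (us.length * G.m * G.n * G.expectedSpread {v₀} * Real.log G.n)) ∧
          (G.n ≤ 2 * G.m →
            AddATP.expectedTime 1 G us c ζ₀ ≤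
              ENNReal.ofReal
                (C * (us.length * G.m * G.n * G.expectedSpread {v₀} * Real.log G.n))) := by
  -- 128 is 8 from the logarithm times 16 from the cost of the RR sets in the second claim; the
  -- final 4 pays for iteration overhead and graph updates. The first claim needs only `16 * (4 + 1
  -- / κ ^ 2)`.
  refine ⟨128 * (4 + 1 / κ ^ 2) + 4, by positivity, ?_⟩
  intro V _ G us c ζ₀ v₀ hn hnodup hus hζ hv₀ hmax
  have hI1 := G.one_le_expectedSpread hv₀
  generalize G.expectedSpread {v₀} = I at hmax hI1 ⊢
  have hn' : (2 : ℝ) ≤ G.n := by exact_mod_cast hn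
  have hlog2 : 0.6931471803 < Real.log 2 := Real.log_two_gt_d9
  have hlogn : Real.log 2 ≤ Real.log G.n := Real.log_le_log (by norm_num) hn'
  have hlog : 1 / 2 < Real.log G.n := by linarith
  -- Without targets `1 / (k n)` would be a division by zero, but then the algorithm takes no time.
  rcases us.eq_nil_or_concat with rfl | hne
  · have h0 : ∀ w : ℕ, AddATP.expectedTime w G [] c ζ₀ ≤ 0 := fun w => by
      change (AddATP.run w G [] c ζ₀).expect (fun s => (s.time : ℝ≥0∞)) ≤ 0
      simp [AddATP.run, AddATP.iterations, PMF.expect_pure]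
    exact ⟨(h0 0).trans (zero_le), fun _ => (h0 1).trans (zero_le)⟩
  have hk : 1 ≤ us.length := by
    obtain ⟨_, _, rfl⟩ := hne
    simp
  -- Distinct targets give `k ≤ n`, which makes `log (k n)` of order `log n`.
  have hkn : us.length ≤ G.n := by
    rw [← List.toFinset_card_of_nodup hnodup]
    exact Finset.card_le_card fun u hu => hus u (List.mem_toFinset.1 hu)
  have hloop := fun (w : ℕ) (H : ProbGraph V) (hHG : H.IsSubgraph G) (hH : H.nodes.Nonempty)
      (u : V) (S T : Finset V) =>
    AddATP.expect_loop_le_of_isSubgraph w hHG hH u (c u) S T hκ hn hk hkn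
      (hζ H.n hH.card_pos (Finset.card_le_card hHG.nodes_subset)).1
      (hζ H.n hH.card_pos (Finset.card_le_card hHG.nodes_subset)).2 hmax
  generalize Real.log G.n = l at *
  have hq : 0 ≤ 1 / κ ^ 2 := by positivity
  generalize 1 / κ ^ 2 = q at *
  have hfinal : ∀ x y : ℝ, x ≤ y * (G.m * G.n * I * l) →
      (us.length : ℝ≥0∞) * ENNReal.ofReal x ≤
        ENNReal.ofReal (y * (us.length * G.m * G.n * I * l)) := by
    intro x y h
    rw [← ENNReal.ofReal_natCast, ← ENNReal.ofReal_mul (by positivity)]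
    refine ENNReal.ofReal_le_ofReal ((mul_le_mul_of_nonneg_left h (by positivity)).trans_eq ?_)
    ring
  have hmn : 0 ≤ G.m * G.n * I * l := by positivity
  refine ⟨?_, fun hnm => ?_⟩
  · refine (AddATP.expectedTime_le 0 G us c ζ₀ (by simp) fun H hHG hH u S T => ?_).trans
      (hfinal (8 * l * (4 + q) * G.n * (2 * (G.m * I))) _ ?_)
    · simpa using hloop 0 H hHG hH u S T
    · have : 0 ≤ q * (G.m * G.n * I * l) := by positivity
      nlinarith
  · have hnm' : (G.n : ℝ) ≤ 2 * G.m := by exact_mod_cast hnm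
    -- From `2 ≤ n ≤ 2 m` follows `m ≥ 1`, hence `1 + n + m ≤ 2 m n`; the other factor 2 comes from
    -- `I * l ≥ 1 / 2`.
    have hB : (1 : ℝ) + G.n + G.m ≤ 4 * (G.m * G.n * I * l) := by
      have hm : 0 ≤ (G.m : ℝ) - 1 := by linarith
      have h1 : (1 : ℝ) + G.n + G.m ≤ 2 * (G.m * G.n) := by nlinarith
      have h2 : 1 / 2 ≤ I * l := by nlinarith
      have h3 : (G.m * G.n : ℝ) * (1 / 2) ≤ G.m * G.n * (I * l) := by gcongr
      linarith
    refine (AddATP.expectedTime_le 1 G us c ζ₀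
      (B := ENNReal.ofReal (8 * l * (4 + q) * G.n *
        (G.n + 2 * (G.m * I + (G.n + 2 * (G.n * I)))) + (1 + G.n + G.m)))
      ?_ fun H hHG hH u S T => ?_).trans (hfinal _ _ ?_)
    · rw [Nat.cast_one, ← ENNReal.ofReal_one]
      refine ENNReal.ofReal_le_ofReal ?_
      have : 0 ≤ 8 * l * (4 + q) * G.n * (G.n + 2 * (G.m * I + (G.n + 2 * (G.n * I)))) := by
        positivity
      linarith [Nat.cast_nonneg (α := ℝ) G.n, Nat.cast_nonneg (α := ℝ) G.m]
    · have h := hloop 1 H hHG hH u S T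
      have hNn : (H.n : ℝ≥0∞) ≤ G.n := Nat.cast_le.2 (Finset.card_le_card hHG.nodes_subset)
      have hMm : (H.m : ℝ≥0∞) ≤ G.m := Nat.cast_le.2 (Finset.card_le_card hHG.edges_subset)
      simp only [Nat.cast_one, one_mul] at h ⊢
      rw [ENNReal.ofReal_add (by positivity) (by positivity),
        ENNReal.ofReal_add (by positivity) (by positivity),
        ENNReal.ofReal_add (by positivity) (by positivity), ENNReal.ofReal_one,
        ENNReal.ofReal_natCast, ENNReal.ofReal_natCast]
      refine (add_le_add (add_le_add_right h 1) (add_le_add hNn hMm)).trans_eq ?_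
      ring
    · have h1 : (G.n : ℝ) + 2 * (G.m * I + (G.n + 2 * (G.n * I))) ≤ 16 * (G.m * I) := by
        have : (G.n : ℝ) * I ≤ 2 * G.m * I := by gcongr
        have : (G.n : ℝ) ≤ G.n * I := le_mul_of_one_le_right (by positivity) hI1
        linarith
      have h2 := mul_le_mul_of_nonneg_left h1 (by positivity : 0 ≤ 8 * l * (4 + q) * G.n)
      calc _ ≤ 8 * l * (4 + q) * G.n * (16 * (G.m * I)) + 4 * (G.m * G.n * I * l) :=
            add_le_add h2 hB
        _ = _ := by ring
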